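/- Let $A$ be an alphabet, $A^*$ the free monoid of all words over $A$ and $\emptyset$ the empty word. A word $w\in A^*$ is square-free if $w=ussv$ with $u,s,v\in A^*$ implies $s=\emptyset$. For a system of defining relations $\pi\subseteq A^*\times A^*$ write $x\leftrightarrow_\pi y$ if there are words $r,s,u,v\in A^*$ with $x=rus$, $y=rvs$ and $(u,v)\in\pi$ or $(v,u)\in\pi$; let $=_\pi$ be the reflexive and transitive closure of $\leftrightarrow_\pi$, and let $[w]_\pi$ be the class of $w$ under $=_\pi$. A word $w$ is square-free relative to $\pi$ if every word in $[w]_\pi$ is square-free. Consider the condition $$(\ast)\qquad \text{for every } w\in A^*:\ \text{if } w \text{ is square-free relative to } \pi, \text{ then } [w]_\pi \text{ is finite.}$$ **Theorem.** Let $n,m\ge 0$ be integers, let $u_1,\dots,u_n\in A^*$ be pairwise distinct words, and let $v_1,\dots,v_m\in A^*$ be pairwise distinct words (a word $u_i$ may coincide with a word $v_k$). Then the system $$\pi=\{(u_i,u_j)\mid 1\le i<j\le n\}\cup\{(v_k,v_l)\mid 1\le k<l\le m\}$$ satisfies condition $(\ast)$. In particular, $(\ast)$ holds for every system of two defining relations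 $\pi=\{(u,v),(r,s)\}$ with $u,v,r,s\in A^*$, $u\ne v$ and $r\ne s$. -/

import Mathlib

/-- Words over the alphabet `A` are finite sequences `List A` with concatenation `++`; the word `w`
is square-free if `w = u s s v` forces `s` to be empty. -/
def SquareFreeWord {A : Type*} (w : List A) : Prop :=
  ∀ u s v : List A, w = u ++ s ++ s ++ v → s = []

/-- Immediate derivability: `x = r u s` and `y = r v s`, where `(u, v)` or `(v, u)` is
a defining relation. -/
def ImmediatelyDerives {A : Type*} (π : Set (List A × List A)) (x y : List A) : Prop :=
  ∃ r s u v : List A, x = r ++ u ++ s ∧ y = r ++ v ++ s ∧ ((u, v) ∈ π ∨ (v, u) ∈ π)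

/-- Equality relative to `π`: the reflexive and transitive closure of immediate derivability. -/
def EqRelativeTo {A : Type*} (π : Set (List A × List A)) : List A → List A → Prop :=
  Relation.ReflTransGen (ImmediatelyDerives π)

/-- The equivalence class `[w]_π`. -/
def wordClass {A : Type*} (π : Set (List A × List A)) (w : List A) : Set (List A) :=
  {x | EqRelativeTo π w x}

/-- The word `w` is square-free relative to `π`: its whole class consists of square-free words. -/
def SquareFreeRelativeTo {A : Type*} (π : Set (List A × List A)) (w : List A) : Prop :=
  ∀ x ∈ wordClass π w, SquareFreeWord x

/-- Condition `(∗)`: every word that is square-free relative to `π` has a finite class. -/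
def ConditionStar {A : Type*} (π : Set (List A × List A)) : Prop :=
  ∀ w : List A, SquareFreeRelativeTo π w → (wordClass π w).Finite

/-- The system of all pairs `(u i, u j)` with `i < j`. -/
def pairSystem {A : Type*} {n : ℕ} (u : Fin n → List A) : Set (List A × List A) :=
  {p | ∃ i j : Fin n, i < j ∧ p = (u i, u j)}

/-! Let `w` be relatively square-free, and let `K true`, `K false` be the classes of the two sets of
words. Every word of `[w]` is cut into single letters and labelled blocks, a block labelled `τ`
being a piece of a word of `K τ`. The cut of `w` into letters starts the process, and rewriting a
word `z` of `K τ` does not increase the number of blocks (`Block.HasBlocks.step`). If `z` lies in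
one block, that block is rewritten. Otherwise `z` becomes a block of its own, which costs an extra
block only if `z` overlaps exactly two blocks, both properly. Those two carry different labels, and
neither label is `τ`, since a piece of a word of `K τ` next to a word of `K τ` creates a square.
With only two labels this is impossible.

So words of `[w]` have at most `|w|` blocks. A block is no longer than the class word it completes
to, and the class words occurring in `[w]` have bounded length
(`IsTwoSetSystem.exists_length_le_of_mem_classOf`). Only finitely many letters occur, so `[w]` is
finite. -/

namespace EqRelativeTo

variable {A : Type*} {π : Set (List A × List A)} {x y z : List A}

theorem refl (x : List A) : EqRelativeTo π x x := Relation.ReflTransGen.refl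

theorem trans (h : EqRelativeTo π x y) (h' : EqRelativeTo π y z) : EqRelativeTo π x z :=
  Relation.ReflTransGen.trans h h'

theorem symm (h : EqRelativeTo π x y) : EqRelativeTo π y x := by
  have : Std.Symm (ImmediatelyDerives π) := by
    refine ⟨?_⟩
    rintro _ _ ⟨r, s, u, v, rfl, rfl, h⟩
    exact ⟨r, s, v, u, rfl, rfl, h.symm⟩
  exact Relation.ReflTransGen.stdSymm.symm _ _ h

theorem append_left (p : List A) (h : EqRelativeTo π x y) :
    EqRelativeTo π (p ++ x) (p ++ y) := by
  refine Relation.ReflTransGen.lift (p ++ ·) ?_ _ _ h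
  rintro _ _ ⟨r, s, u, v, rfl, rfl, h⟩
  exact ⟨p ++ r, s, u, v, by simp, by simp, h⟩

theorem append_right (q : List A) (h : EqRelativeTo π x y) :
    EqRelativeTo π (x ++ q) (y ++ q) := by
  refine Relation.ReflTransGen.lift (· ++ q) ?_ _ _ h
  rintro _ _ ⟨r, s, u, v, rfl, rfl, h⟩
  exact ⟨r, s ++ q, u, v, by simp, by simp, h⟩

theorem append {x' y' : List A} (h : EqRelativeTo π x y) (h' : EqRelativeTo π x' y') :
    EqRelativeTo π (x ++ x') (y ++ y') :=
  (h.append_right x').trans (h'.append_left y)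

end EqRelativeTo

namespace SquareFreeRelativeTo

variable {A : Type*} {π : Set (List A × List A)} {w : List A}

theorem eq_nil_of_square (hw : SquareFreeRelativeTo π w) {u s v : List A}
    (h : EqRelativeTo π w (u ++ s ++ s ++ v)) : s = [] :=
  hw _ h u s v rfl

/-- A factor of a relatively square-free word is relatively square-free. -/
theorem of_factor (hw : SquareFreeRelativeTo π w) {p x q : List A}
    (h : EqRelativeTo π w (p ++ x ++ q)) : SquareFreeRelativeTo π x := by
  rintro y hy u s v rfl
  refine hw.eq_nil_of_square (u := p ++ u) (v := v ++ q) (h.trans ?_)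
  simpa using (EqRelativeTo.append_left p hy).append_right q

/-- A relatively square-free word is not equal to a proper extension of itself. -/
theorem eq_nil_of_extension (hw : SquareFreeRelativeTo π w) {x y : List A}
    (h : EqRelativeTo π w (x ++ w ++ y)) : x = [] ∧ y = [] := by
  -- Applying the extension to itself turns `xwy` into `xxwyy`, which has squares at both ends.
  have h2 : EqRelativeTo π w (x ++ (x ++ w ++ y) ++ y) :=
    h.trans ((h.append_left x).append_right y)
  exact ⟨hw.eq_nil_of_square (u := []) (v := w ++ y ++ y) (by simpa using h2),
    hw.eq_nil_of_square (u := x ++ x ++ w) (v := []) (by simpa using h2)⟩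

end SquareFreeRelativeTo

/-! ### Pieces of class words -/

/-- The factor `B` of `P ++ B ++ R` is what is left of a word of `K`: up to equality relative to
`π`, its two contexts complete it to a word of `K`. -/
def IsPiece {A : Type*} (π : Set (List A × List A)) (K : Set (List A)) (P B R : List A) : Prop :=
  ∃ P₀ t t' R₀, EqRelativeTo π P (P₀ ++ t) ∧ EqRelativeTo π R (t' ++ R₀) ∧ t ++ B ++ t' ∈ K

/-- A class of words under equality relative to `π`, or the empty set. -/
structure IsClass {A : Type*} (π : Set (List A × List A)) (K : Set (List A)) : Prop where
  eqRel : ∀ {x y}, x ∈ K → y ∈ K → EqRelativeTo π x y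
  mem : ∀ {x y}, x ∈ K → EqRelativeTo π x y → y ∈ K

namespace IsPiece

variable {A : Type*} {π : Set (List A × List A)} {K : Set (List A)} {w P B R : List A}

theorem of_mem (h : B ∈ K) : IsPiece π K P B R :=
  ⟨P, [], [], R, by simpa using EqRelativeTo.refl P, EqRelativeTo.refl R, by simpa using h⟩

theorem congr {P' R' : List A} (h : IsPiece π K P B R) (hP : EqRelativeTo π P P')
    (hR : EqRelativeTo π R R') : IsPiece π K P' B R' := by
  obtain ⟨P₀, t, t', R₀, h1, h2, h3⟩ := h
  exact ⟨P₀, t, t', R₀, hP.symm.trans h1, hR.symm.trans h2, h3⟩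

theorem rewrite (hK : IsClass π K) {B' : List A} (h : IsPiece π K P B R)
    (hB : EqRelativeTo π B B') : IsPiece π K P B' R := by
  obtain ⟨P₀, t, t', R₀, h1, h2, h3⟩ := h
  exact ⟨P₀, t, t', R₀, h1, h2, hK.mem h3 ((hB.append_left t).append_right t')⟩

theorem left {B' : List A} (h : IsPiece π K P (B ++ B') R) : IsPiece π K P B (B' ++ R) := by
  obtain ⟨P₀, t, t', R₀, h1, h2, h3⟩ := h
  exact ⟨P₀, t, B' ++ t', R₀, h1, by simpa using h2.append_left B', by simpa using h3⟩

theorem right {B' : List A} (h : IsPiece π K P (B ++ B') R) : IsPiece π K (P ++ B) B' R := by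
  obtain ⟨P₀, t, t', R₀, h1, h2, h3⟩ := h
  exact ⟨P₀, t ++ B, t', R₀, by simpa using h1.append_right B, h2, by simpa using h3⟩

/-- With `P` equal to `P₀t` and `z` equal to `tBt'`, the word `PBzR` becomes `P₀(tB)(tB)t'R`, so
`tB` is empty. -/
theorem eq_nil_of_adjacent_right (hw : SquareFreeRelativeTo π w) (hK : IsClass π K)
    {z : List A} (hz : z ∈ K) (h : IsPiece π K P B (z ++ R))
    (hx : EqRelativeTo π w (P ++ B ++ z ++ R)) : B = [] := by
  obtain ⟨P₀, t, t', R₀, h1, -, h3⟩ := h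
  have : t ++ B = [] := by
    refine hw.eq_nil_of_square (u := P₀) (v := t' ++ R) (hx.trans ?_)
    simpa using ((h1.append_right B).append (hK.eqRel hz h3)).append_right R
  simp_all

theorem eq_nil_of_adjacent_left (hw : SquareFreeRelativeTo π w) (hK : IsClass π K)
    {z : List A} (hz : z ∈ K) (h : IsPiece π K (P ++ z) B R)
    (hx : EqRelativeTo π w (P ++ z ++ B ++ R)) : B = [] := by
  obtain ⟨P₀, t, t', R₀, -, h2, h3⟩ := h
  have : B ++ t' = [] := by
    refine hw.eq_nil_of_square (u := P ++ t) (v := R₀) (hx.trans ?_)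
    simpa using (((hK.eqRel hz h3).append_left P).append_right B).append h2
  simp_all

end IsPiece

/-! ### Cutting words into blocks -/

/-- A nonempty factor of a word; it is a single letter if it has no label. -/
abbrev Block (A : Type*) := Option Bool × List A

namespace Block

variable {A : Type*} {π : Set (List A × List A)} {K : Bool → Set (List A)} {w : List A}

/-- The word made of a list of blocks. -/
def word (bs : List (Block A)) : List A := (bs.map Prod.snd).flatten

@[simp] theorem word_nil : word ([] : List (Block A)) = [] := rfl

@[simp] theorem word_cons (b : Block A) (bs : List (Block A)) :
    word (b :: bs) = b.2 ++ word bs := rfl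

@[simp] theorem word_append (bs cs : List (Block A)) : word (bs ++ cs) = word bs ++ word cs := by
  simp [word]

/-- A block with label `τ` is a piece of a word of `K τ`. -/
def IsValid (π : Set (List A × List A)) (K : Bool → Set (List A)) (P : List A) (b : Block A)
    (R : List A) : Prop :=
  match b.1 with
  | none => b.2.length = 1
  | some τ => b.2 ≠ [] ∧ IsPiece π (K τ) P b.2 R

/-- All blocks of a list, standing between `P` and `R`, are valid. -/
def AllValid (π : Set (List A × List A)) (K : Bool → Set (List A)) :
    List A → List (Block A) → List A → Prop
  | _, [], _ => True
  | P, b :: bs, R => IsValid π K P b (word bs ++ R) ∧ AllValid π K (P ++ b.2) bs R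

theorem IsValid.congr {P P' R R' : List A} {b : Block A} (h : IsValid π K P b R)
    (hP : EqRelativeTo π P P') (hR : EqRelativeTo π R R') : IsValid π K P' b R' := by
  obtain ⟨_ | τ, B⟩ := b
  · exact h
  · exact ⟨h.1, h.2.congr hP hR⟩

theorem AllValid.congr {P P' R R' : List A} {bs : List (Block A)} (h : AllValid π K P bs R)
    (hP : EqRelativeTo π P P') (hR : EqRelativeTo π R R') : AllValid π K P' bs R' := by
  induction bs generalizing P P' with
  | nil => trivial
  | cons b bs ih =>
    exact ⟨h.1.congr hP (hR.append_left _), ih h.2 (hP.append_right _)⟩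

theorem allValid_append {P R : List A} {bs cs : List (Block A)} :
    AllValid π K P (bs ++ cs) R ↔
      AllValid π K P bs (word cs ++ R) ∧ AllValid π K (P ++ word bs) cs R := by
  induction bs generalizing P with
  | nil => simp [AllValid]
  | cons b bs ih => simp [AllValid, ih, and_assoc]

/-- Consecutive blocks do not have the same label. -/
def Separated (bs : List (Block A)) : Prop :=
  List.IsChain (fun l l' : Option Bool => ∀ τ, l = some τ → l' ≠ some τ) (bs.map Prod.fst)

/-- A cut of a word of blocks lies between two blocks or inside a block. -/
theorem cut {bs : List (Block A)} {P Q : List A} (h : word bs = P ++ Q) :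
    (∃ cs ds, bs = cs ++ ds ∧ word cs = P ∧ word ds = Q) ∨
    ∃ cs l B B' ds, B ≠ [] ∧ B' ≠ [] ∧ bs = cs ++ (l, B ++ B') :: ds ∧
      P = word cs ++ B ∧ Q = B' ++ word ds := by
  induction bs generalizing P with
  | nil => exact Or.inl ⟨[], [], by simp_all⟩
  | cons b bs ih =>
    rw [word_cons] at h
    rcases List.append_eq_append_iff.1 h with ⟨P', rfl, h'⟩ | ⟨B', h1, rfl⟩
    · rcases ih h' with ⟨cs, ds, rfl, rfl, rfl⟩ | ⟨cs, l, B, B', ds, hB, hB', rfl, rfl, rfl⟩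
      · exact Or.inl ⟨b :: cs, ds, by simp⟩
      · exact Or.inr ⟨b :: cs, l, B, B', ds, hB, hB', by simp⟩
    · obtain ⟨l, C⟩ := b
      obtain rfl : C = P ++ B' := h1
      by_cases hP : P = []
      · exact Or.inl ⟨[], (l, P ++ B') :: bs, by simp [hP]⟩
      by_cases hB : B' = []
      · exact Or.inl ⟨[(l, P ++ B')], bs, by simp [hB]⟩
      · exact Or.inr ⟨[], l, P, B', bs, hP, hB, by simp⟩

theorem IsValid.left {P R B B' : List A} {l : Option Bool} (hB : B ≠ []) (hB' : B' ≠ [])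
    (h : IsValid π K P (l, B ++ B') R) : IsValid π K P (l, B) (B' ++ R) := by
  obtain _ | τ := l
  · have : (B ++ B').length = 1 := h
    have := List.length_pos_iff.2 hB
    have := List.length_pos_iff.2 hB'
    simp at *
    omega
  · exact ⟨hB, h.2.left⟩

theorem IsValid.right {P R B B' : List A} {l : Option Bool} (hB : B ≠ []) (hB' : B' ≠ [])
    (h : IsValid π K P (l, B ++ B') R) : IsValid π K (P ++ B) (l, B') R := by
  obtain _ | τ := l
  · have : (B ++ B').length = 1 := h
    have := List.length_pos_iff.2 hB
    have := List.length_pos_iff.2 hB'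
    simp at *
    omega
  · exact ⟨hB', h.2.right⟩

theorem IsValid.label_ne_none {P R B B' : List A} {l : Option Bool} (hB : B ≠ []) (hB' : B' ≠ [])
    (h : IsValid π K P (l, B ++ B') R) : l ≠ none := by
  rintro rfl
  have : (B ++ B').length = 1 := h
  have := List.length_pos_iff.2 hB
  have := List.length_pos_iff.2 hB'
  simp at *
  omega

/-- Replacing a word of `K τ` that stands between two lists of blocks by a block. -/
theorem allValid_separated_insert (hw : SquareFreeRelativeTo π w) (hK : ∀ σ, IsClass π (K σ))
    {cs ds : List (Block A)} {τ : Bool} {z z' : List A} (hz : z ∈ K τ) (hz' : z' ∈ K τ)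
    (hne : z' ≠ []) (hcs : AllValid π K [] cs (z ++ word ds))
    (hds : AllValid π K (word cs ++ z) ds []) (scs : Separated cs) (sds : Separated ds)
    (hx : EqRelativeTo π w (word cs ++ z ++ word ds)) :
    AllValid π K [] (cs ++ (some τ, z') :: ds) [] ∧ Separated (cs ++ (some τ, z') :: ds) := by
  have hzz := (hK τ).eqRel hz hz'
  refine ⟨allValid_append.2 ⟨hcs.congr (.refl _) ?_, ⟨hne, .of_mem hz'⟩, hds.congr ?_ (.refl _)⟩, ?_⟩
  · simpa using hzz.append_right _
  · simpa using hzz.append_left _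
  have h1 : Separated ((some τ, z') :: ds) := by
    cases ds with
    | nil => simp [Separated]
    | cons b ds =>
      refine List.IsChain.cons_cons ?_ sds
      rintro σ ⟨⟩ hb
      obtain ⟨l, B⟩ := b
      obtain rfl : l = some τ := hb
      refine hds.1.1 (hds.1.2.eq_nil_of_adjacent_left hw (hK τ) hz ?_)
      simpa using hx
  unfold Separated at scs h1 ⊢
  rw [List.map_append, List.isChain_append]
  refine ⟨scs, h1, ?_⟩
  rintro l hl l' hl' σ rfl rfl
  obtain rfl : τ = σ := by simpa using hl'
  rcases List.eq_nil_or_concat cs with rfl | ⟨cs, b, rfl⟩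
  · simp at hl
  obtain ⟨l, B⟩ := b
  obtain rfl : l = some τ := by simpa using hl
  have hb : IsValid π K (word cs) (some τ, B) (z ++ word ds) := by
    rw [List.concat_eq_append] at hcs
    simpa using (allValid_append.1 hcs).2.1
  refine hb.1 (hb.2.eq_nil_of_adjacent_right hw (hK τ) hz ?_)
  simpa using hx

/-- Replacing a word inside a block. -/
theorem allValid_rewrite (hK : ∀ σ, IsClass π (K σ)) {cs ds : List (Block A)} {σ : Bool}
    {B B' : List A} (hB : EqRelativeTo π B B') (hne : B' ≠ [])
    (h : AllValid π K [] (cs ++ (some σ, B) :: ds) []) :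
    AllValid π K [] (cs ++ (some σ, B') :: ds) [] := by
  obtain ⟨h1, h2, h3⟩ := allValid_append.1 h
  refine allValid_append.2 ⟨h1.congr (.refl _) ?_, ⟨hne, h2.2.rewrite (hK σ) hB⟩,
    h3.congr (hB.append_left _) (.refl _)⟩
  simpa using hB.append_right _

theorem Separated.append_left {cs ds : List (Block A)} (h : Separated (cs ++ ds)) :
    Separated cs := by
  unfold Separated at *
  rw [List.map_append] at h
  exact h.left_of_append

theorem Separated.append_right {cs ds : List (Block A)} (h : Separated (cs ++ ds)) :
    Separated ds := by
  unfold Separated at *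
  rw [List.map_append] at h
  exact h.right_of_append

theorem Separated.congr {cs ds : List (Block A)} (h : Separated cs)
    (hm : cs.map Prod.fst = ds.map Prod.fst) : Separated ds := by
  unfold Separated at *
  rwa [← hm]

/-- The word `x` is cut into at most `n` valid blocks with labels from `T`. -/
def HasBlocks (π : Set (List A × List A)) (K : Bool → Set (List A)) (T : Set Bool) (n : ℕ)
    (x : List A) : Prop :=
  ∃ bs : List (Block A), word bs = x ∧ AllValid π K [] bs [] ∧ Separated bs ∧ bs.length ≤ n ∧
    ∀ b ∈ bs, ∀ σ, b.1 = some σ → σ ∈ T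

theorem hasBlocks_letters (T : Set Bool) (x : List A) : HasBlocks π K T x.length x := by
  refine ⟨x.map fun a => (none, [a]), ?_, ?_, ?_, by simp, by simp⟩
  · induction x with
    | nil => rfl
    | cons a x ih => simp [ih]
  · suffices ∀ P, AllValid π K P (x.map fun a => (none, [a])) [] from this []
    intro P
    induction x generalizing P with
    | nil => trivial
    | cons a x ih => exact ⟨rfl, ih _⟩
  · unfold Separated
    induction x with
    | nil => simp
    | cons a x ih =>
      cases x with
      | nil => simp
      | cons b x => exact List.IsChain.cons_cons (by simp) ih

/-- A labelled block is a factor of its completion `tBt'`, which occurs in a word equal to `x` and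
so has length at most `M`. The condition `1 ≤ M` serves the single letters. -/
theorem HasBlocks.length_le {T : Set Bool} {n M : ℕ} {x : List A} (h : HasBlocks π K T n x)
    (hM : 1 ≤ M)
    (hT : ∀ σ ∈ T, ∀ P z R, z ∈ K σ → EqRelativeTo π x (P ++ z ++ R) → z.length ≤ M) :
    x.length ≤ n * M := by
  obtain ⟨bs, rfl, hv, -, hn, hl⟩ := h
  refine le_trans ?_ (Nat.mul_le_mul_right M hn)
  have key : ∀ P, AllValid π K P bs [] →
      (∀ σ ∈ T, ∀ P' z R, z ∈ K σ → EqRelativeTo π (P ++ word bs) (P' ++ z ++ R) →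
        z.length ≤ M) → (word bs).length ≤ bs.length * M := by
    clear hv hn hT
    intro P hv hT
    induction bs generalizing P with
    | nil => simp
    | cons b bs ih =>
      have h1 := ih (fun b' hb' => hl b' (List.mem_cons_of_mem _ hb')) (P ++ b.2) hv.2
        (by simpa using hT)
      have h2 : b.2.length ≤ M := by
        obtain ⟨_ | σ, B⟩ := b
        · exact (show B.length = 1 from hv.1).le.trans hM
        · obtain ⟨-, P₀, t, t', R₀, e1, e2, e3⟩ := hv.1
          have := hT σ (hl (some σ, B) (by simp) σ rfl) P₀ _ R₀ e3
            (by simpa using e1.append (e2.append_left B))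
          simp at this ⊢
          omega
      simp [Nat.add_mul]
      omega
  exact key [] hv hT

/-- A rewriting step does not increase the number of blocks. -/
theorem HasBlocks.step (hw : SquareFreeRelativeTo π w) (hK : ∀ σ, IsClass π (K σ)) {T : Set Bool}
    {n : ℕ} {τ : Bool} (hτ : τ ∈ T) {P R z z' : List A} (hz : z ∈ K τ) (hz' : z' ∈ K τ)
    (hx : EqRelativeTo π w (P ++ z ++ R)) (h : HasBlocks π K T n (P ++ z ++ R)) :
    HasBlocks π K T n (P ++ z' ++ R) := by
  have hzz := (hK τ).eqRel hz hz'
  have hx' : EqRelativeTo π w (P ++ z' ++ R) :=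
    hx.trans ((hzz.append_left P).append_right R)
  -- If the empty word of `K τ` occurs, inserting `y'` twice gives a square; hence the empty word is
  -- only ever rewritten to itself.
  have hnil : ∀ {y y'}, y ∈ K τ → y' ∈ K τ → EqRelativeTo π w (P ++ y ++ R) → y = [] →
      y' = [] := by
    rintro _ y' hy hy' hxy rfl
    have e := (hK τ).eqRel hy hy'
    refine hw.eq_nil_of_square (u := P) (v := R) (hxy.trans ?_)
    simpa using ((e.append e).append_left P).append_right R
  by_cases hne : z = []
  · rwa [hnil hz hz' hx hne, ← hne]
  have hne' : z' ≠ [] := fun h' => hne (hnil hz' hz hx' h')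
  obtain ⟨bs, hword, hv, hs, hn, hl⟩ := h
  -- the occurrence of `z` is a proper part of one block
  have inside : ∀ cs l B C ds, bs = cs ++ (l, B ++ z ++ C) :: ds → B ++ C ≠ [] →
      P = word cs ++ B → R = C ++ word ds → HasBlocks π K T n (P ++ z' ++ R) := by
    rintro cs l B C ds rfl hBC rfl rfl
    obtain _ | σ := l
    · have h1 : (B ++ z ++ C).length = 1 := (allValid_append.1 hv).2.1
      have := List.length_pos_iff.2 hBC
      have := List.length_pos_iff.2 hne
      simp at *
      omega
    · refine ⟨cs ++ (some σ, B ++ z' ++ C) :: ds, by simp, allValid_rewrite hK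
        ((hzz.append_left B).append_right C) (by simp [hne']) hv, hs.congr (by simp),
        by simpa using hn, fun b hb ρ hρ => ?_⟩
      rcases List.mem_append.1 hb with hb | hb
      · exact hl b (by simp [hb]) ρ hρ
      rcases List.mem_cons.1 hb with rfl | hb
      · exact hl (some σ, B ++ z ++ C) (by simp) ρ hρ
      · exact hl b (by simp [hb]) ρ hρ
  -- the occurrence of `z` stands between two lists of blocks
  have insert : ∀ cs ds, word cs = P → word ds = R → AllValid π K [] cs (z ++ R) →
      AllValid π K (P ++ z) ds [] → Separated cs → Separated ds →
      (∀ b ∈ cs ++ ds, ∀ σ, b.1 = some σ → σ ∈ T) → cs.length + ds.length + 1 ≤ n →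
      HasBlocks π K T n (P ++ z' ++ R) := by
    rintro cs ds rfl rfl h1 h2 s1 s2 hl' hn'
    obtain ⟨h3, h4⟩ := allValid_separated_insert hw hK hz hz' hne' h1 h2 s1 s2 hx
    refine ⟨_, by simp, h3, h4, by simp; omega, fun b hb ρ hρ => ?_⟩
    rcases List.mem_append.1 hb with hb | hb
    · exact hl' b (by simp [hb]) ρ hρ
    rcases List.mem_cons.1 hb with rfl | hb
    · obtain rfl : τ = ρ := by simpa using hρ
      exact hτ
    · exact hl' b (by simp [hb]) ρ hρ
  rw [List.append_assoc] at hword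
  -- The cases are the positions of the two ends of `z`. Outside a single block, `z` swallows at
  -- least one whole block, which pays for the new one, except in the case excluded below.
  rcases cut hword with ⟨cs, ds, rfl, hP, hds⟩ | ⟨cs, l, B, B', ds, hB, hB', rfl, hP, hQ⟩
  · obtain ⟨v1, v2⟩ := allValid_append.1 hv
    rw [List.nil_append, hP] at v2
    rw [hds, List.append_nil] at v1
    rcases cut hds with ⟨ms, es, rfl, hm, he⟩ | ⟨ms, l, C, C', es, hC, hC', rfl, hm, he⟩
    · rw [allValid_append, hm] at v2
      refine insert cs es hP he v1 v2.2 hs.append_left hs.append_right.append_right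
        (fun b hb => hl b (by simp at hb ⊢; tauto)) ?_
      have : ms ≠ [] := by rintro rfl; exact hne hm.symm
      have := List.length_pos_iff.2 this
      simp at hn
      omega
    · by_cases hms : ms = []
      · subst hms
        exact inside cs l [] C' es (by simp [hm]) (by simp [hC']) (by simp [hP]) he
      · obtain ⟨-, v3, v4⟩ := allValid_append.1 v2
        refine insert cs ((l, C') :: es) hP (by simp [he]) v1 ⟨?_, ?_⟩ hs.append_left
          (hs.append_right.append_right.congr (by simp)) (fun b hb => ?_) ?_
        · simpa [hm] using v3.right hC hC'
        · simpa [hm] using v4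
        · intro σ hσ
          rcases List.mem_append.1 hb with hb | hb
          · exact hl b (by simp [hb]) σ hσ
          rcases List.mem_cons.1 hb with rfl | hb
          · exact hl (l, C ++ C') (by simp) σ hσ
          · exact hl b (by simp [hb]) σ hσ
        · have := List.length_pos_iff.2 hms
          simp at hn ⊢
          omega
  · obtain ⟨v1, v2, v3⟩ := allValid_append.1 hv
    have s1 : Separated (cs ++ [(l, B)]) := by
      refine Separated.append_left (ds := ds) (hs.congr (by simp))
    have w1 : AllValid π K [] (cs ++ [(l, B)]) (z ++ R) := by
      refine allValid_append.2 ⟨by simpa [hQ] using v1, ?_, trivial⟩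
      simpa [hQ] using v2.left hB hB'
    rcases List.append_eq_append_iff.1 hQ with ⟨C, rfl, hR⟩ | ⟨z₂, hz₂, hds⟩
    · exact inside cs l B C ds (by simp) (by simp [hB]) hP hR
    by_cases hz₂' : z₂ = []
    · exact inside cs l B [] ds (by simp [hz₂, hz₂']) (by simp [hB]) hP (by simp [hds, hz₂'])
    have hPz : P ++ z = [] ++ word cs ++ (B ++ B') ++ z₂ := by simp [hP, hz₂]
    rcases cut hds with ⟨ms, es, rfl, hm, he⟩ | ⟨ms, l', C, C', es, hC, hC', rfl, hm, he⟩
    · obtain ⟨-, v4⟩ := allValid_append.1 v3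
      rw [hm, ← hPz] at v4
      refine insert _ es (by simp [hP]) he w1 v4 s1
        (hs.append_right.append_right (cs := (l, B ++ B') :: ms)) (fun b hb => ?_) ?_
      · intro σ hσ
        simp only [List.mem_append, List.mem_singleton] at hb
        rcases hb with (hb | rfl) | hb
        · exact hl b (by simp [hb]) σ hσ
        · exact hl (l, B ++ B') (by simp) σ hσ
        · exact hl b (by simp [hb]) σ hσ
      · have : ms ≠ [] := by rintro rfl; exact hz₂' hm.symm
        have := List.length_pos_iff.2 this
        simp at hn ⊢
        omega
    · obtain ⟨-, v4, v5⟩ := allValid_append.1 v3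
      have w2 : AllValid π K (P ++ z) ((l', C') :: es) [] := by
        refine ⟨?_, ?_⟩
        · simpa [hPz, hm] using v4.right hC hC'
        · simpa [hPz, hm] using v5
      have s2 : Separated ((l', C') :: es) := by
        refine Separated.congr (cs := (l', C ++ C') :: es) ?_ (by simp)
        exact hs.append_right.append_right (cs := (l, B ++ B') :: ms)
      have hcs : word (cs ++ [(l, B)]) = P := by simp [hP]
      have hes : word ((l', C') :: es) = R := by simp [he]
      -- With `ms` empty, `z` overlaps two neighbouring blocks properly and swallows none. Then `l`,
      -- `some τ`, `l'` would be three pairwise different labels out of two.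
      by_cases hms : ms = []
      · subst hms
        exfalso
        have n1 : l ≠ none := v2.label_ne_none hB hB'
        have n2 : l' ≠ none := v4.label_ne_none hC hC'
        obtain ⟨-, s3⟩ := allValid_separated_insert hw hK hz hz' hne' (hes ▸ w1) (hcs ▸ w2)
          s1 s2 (by simpa only [hcs, hes] using hx)
        have s4 : Separated ((l, B ++ B') :: (l', C ++ C') :: es) := hs.append_right
        have s5 : Separated ((l, B) :: (some τ, z') :: (l', C') :: es) := by
          rw [List.append_assoc] at s3
          exact s3.append_right
        simp only [Separated, List.map_cons, List.isChain_cons_cons] at s4 s5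
        obtain ⟨σ, rfl⟩ := Option.ne_none_iff_exists'.1 n1
        obtain ⟨ρ, rfl⟩ := Option.ne_none_iff_exists'.1 n2
        have q1 := s4.1 σ rfl
        have q2 := s5.1 σ rfl
        have q3 := s5.2.1 τ rfl
        revert q1 q2 q3
        cases σ <;> cases τ <;> cases ρ <;> simp
      · refine insert _ _ hcs hes w1 w2 s1 s2 (fun b hb => ?_) ?_
        · intro σ hσ
          simp only [List.mem_append, List.mem_cons, List.not_mem_nil, or_false] at hb
          rcases hb with (hb | rfl) | rfl | hb
          · exact hl b (by simp [hb]) σ hσ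
          · exact hl (l, B ++ B') (by simp) σ hσ
          · exact hl (l', C ++ C') (by simp) σ hσ
          · exact hl b (by simp [hb]) σ hσ
        · have := List.length_pos_iff.2 hms
          simp at hn ⊢
          omega

end Block

/-! ### Systems on two sets and the length bounds -/

/-- The defining relations are relations between words of `X true` and between words of `X false`,
and the words of each of these two sets are equal relative to `π`. -/
structure IsTwoSetSystem {A : Type*} (π : Set (List A × List A)) (X : Bool → Set (List A)) :
    Prop where
  mem : ∀ {a b}, (a, b) ∈ π → ∃ τ, a ∈ X τ ∧ b ∈ X τ
  eqRel : ∀ {τ a b}, a ∈ X τ → b ∈ X τ → EqRelativeTo π a b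

namespace IsTwoSetSystem

variable {A : Type*} {π : Set (List A × List A)} {X : Bool → Set (List A)} {w : List A}

/-- All words that are equal to a word of `X τ` relative to `π`. -/
def classOf (π : Set (List A × List A)) (X : Bool → Set (List A)) (τ : Bool) : Set (List A) :=
  {z | ∃ a ∈ X τ, EqRelativeTo π a z}

theorem mem_classOf {τ : Bool} {a : List A} (ha : a ∈ X τ) : a ∈ classOf π X τ :=
  ⟨a, ha, .refl a⟩

theorem isClass (h : IsTwoSetSystem π X) (τ : Bool) : IsClass π (classOf π X τ) where
  eqRel := by
    rintro x y ⟨a, ha, hx⟩ ⟨b, hb, hy⟩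
    exact hx.symm.trans ((h.eqRel ha hb).trans hy)
  mem := by
    rintro x y ⟨a, ha, hx⟩ hy
    exact ⟨a, ha, hx.trans hy⟩

/-- Induction along a derivation, step by step. -/
theorem induction (h : IsTwoSetSystem π X) {p : List A → Prop} {a x : List A}
    (hx : EqRelativeTo π a x) (ha : p a)
    (step : ∀ P R τ z z', z ∈ X τ → z' ∈ X τ → EqRelativeTo π a (P ++ z ++ R) →
      p (P ++ z ++ R) → p (P ++ z' ++ R)) : p x := by
  induction hx with
  | refl => exact ha
  | tail hy hyz ih =>
    obtain ⟨P, R, z, z', rfl, rfl, hz | hz⟩ := hyz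
    · obtain ⟨τ, h1, h2⟩ := h.mem hz
      exact step P R τ z z' h1 h2 hy ih
    · obtain ⟨τ, h1, h2⟩ := h.mem hz
      exact step P R τ z z' h2 h1 hy ih

/-- Words of one class do not properly contain each other. -/
theorem eq_nil_of_mem (h : IsTwoSetSystem π X) (hw : SquareFreeRelativeTo π w) {τ : Bool}
    {P R p z q : List A} (hz : z ∈ classOf π X τ) (hx : EqRelativeTo π w (P ++ z ++ R))
    (hz' : p ++ z ++ q ∈ classOf π X τ) : p = [] ∧ q = [] :=
  (hw.of_factor hx).eq_nil_of_extension ((h.isClass τ).eqRel hz hz')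

/-- No word of `X τ` lies properly inside a word of its own class. If no word of `X (!τ)` does so
either, `K τ` arises by replacing whole words and the bound is `M`. Otherwise the words of `K (!τ)`
have length at most `M`, and block counting with the single label `!τ` bounds `K τ` by `M * M`. -/
theorem exists_length_le_of_mem_classOf (h : IsTwoSetSystem π X) (hw : SquareFreeRelativeTo π w)
    {M : ℕ} (hM : 1 ≤ M) (hXM : ∀ τ, ∀ a ∈ X τ, a.length ≤ M) (τ : Bool) :
    ∃ L, ∀ P z R, z ∈ classOf π X τ → EqRelativeTo π w (P ++ z ++ R) → z.length ≤ L := by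
  by_cases hocc : ∃ P a R, a ∈ X τ ∧ EqRelativeTo π w (P ++ a ++ R)
  swap
  -- No word of the class occurs, so the bound 0 holds vacuously.
  · refine ⟨0, fun P z R ⟨a, ha, haz⟩ hx => absurd ⟨P, a, R, ha, hx.trans ?_⟩ hocc⟩
    exact (haz.symm.append_left P).append_right R
  obtain ⟨P₀, a, R₀, ha, hPaR⟩ := hocc
  have hctx : ∀ {z}, z ∈ classOf π X τ → EqRelativeTo π w (P₀ ++ z ++ R₀) := fun hz =>
    hPaR.trans ((((h.isClass τ).eqRel (mem_classOf ha) hz).append_left P₀).append_right R₀)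
  have hself : ∀ {p z q}, z ∈ X τ → p ++ z ++ q ∈ classOf π X τ → p = [] ∧ q = [] :=
    fun hz => h.eq_nil_of_mem hw (mem_classOf hz) (hctx (mem_classOf hz))
  have hzctx : ∀ {z}, z ∈ classOf π X τ → EqRelativeTo π a z :=
    (h.isClass τ).eqRel (mem_classOf ha)
  by_cases hcon : ∀ p b q, b ∈ X (!τ) → p ++ b ++ q ∈ classOf π X τ → p = [] ∧ q = []
  · refine ⟨M, fun P z R hz _ => ?_⟩
    refine h.induction (p := fun z => z.length ≤ M) (hzctx hz) (hXM τ a ha) ?_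
    intro p q ρ z z' hz₁ hz' hx _
    have hmem := (h.isClass τ).mem (mem_classOf ha) hx
    have : p = [] ∧ q = [] := by
      rcases Bool.eq_or_eq_not ρ τ with rfl | rfl
      · exact hself hz₁ hmem
      · exact hcon p z q hz₁ hmem
    simpa [this.1, this.2] using hXM ρ z' hz'
  push Not at hcon
  obtain ⟨s, b, t, hb, hsbt, hst⟩ := hcon
  have hbctx : ∀ {y}, y ∈ classOf π X (!τ) → s ++ y ++ t ∈ classOf π X τ := fun hy =>
    (h.isClass τ).mem hsbt
      ((((h.isClass _).eqRel (mem_classOf hb) hy).append_left s).append_right t)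
  -- A word of `X τ` inside a word of `K (!τ)` would, between `s` and `t`, lie properly inside a
  -- word of `K τ`.
  have hlit : ∀ y ∈ classOf π X (!τ), y.length ≤ M := by
    intro y hy
    refine h.induction (p := fun z => z.length ≤ M) ((h.isClass _).eqRel (mem_classOf hb) hy)
      (hXM _ b hb) ?_
    intro p q ρ z z' hz hz' hx _
    have hmem := (h.isClass _).mem (mem_classOf hb) hx
    have : p = [] ∧ q = [] := by
      rcases Bool.eq_or_eq_not ρ τ with rfl | rfl
      · have h1 := hbctx hmem
        have h2 := hself (p := s ++ p) (q := q ++ t) hz (by simpa using h1)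
        simp at h2
        exact absurd h2.2.2 (hst h2.1.1)
      · refine h.eq_nil_of_mem hw (P := P₀ ++ s) (R := t ++ R₀) (mem_classOf hz) ?_ hmem
        simpa using hctx (hbctx (mem_classOf hz))
    simpa [this.1, this.2] using hXM ρ z' hz'
  refine ⟨M * M, fun P z R hz _ => ?_⟩
  have key : Block.HasBlocks π (classOf π X) {!τ} M z := by
    have mono : ∀ {c}, c ∈ X τ → Block.HasBlocks π (classOf π X) {!τ} M c := by
      intro c hc
      obtain ⟨bs, h1, h2, h3, h4, h5⟩ := Block.hasBlocks_letters (π := π) (K := classOf π X) {!τ} c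
      exact ⟨bs, h1, h2, h3, h4.trans (hXM τ c hc), h5⟩
    refine h.induction (hzctx hz) (mono ha) ?_
    intro p q ρ z z' hz₁ hz' hx ih
    rcases Bool.eq_or_eq_not ρ τ with rfl | rfl
    -- A step with `X τ` replaces the whole word, so the count restarts from the at most `M` letters
    -- of `z'`.
    · obtain ⟨rfl, rfl⟩ := hself hz₁ ((h.isClass ρ).mem (mem_classOf ha) hx)
      simpa using mono hz'
    · exact ih.step (hw.of_factor hPaR) h.isClass (Set.mem_singleton _) (mem_classOf hz₁) (mem_classOf hz') hx
  refine key.length_le hM ?_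
  rintro σ rfl _ y _ hy _
  exact hlit y hy

theorem exists_length_le (h : IsTwoSetSystem π X) (hX : ∀ τ, (X τ).Finite)
    (hw : SquareFreeRelativeTo π w) : ∃ N, ∀ x ∈ wordClass π w, x.length ≤ N := by
  have hM : ∃ M, 1 ≤ M ∧ ∀ τ, ∀ a ∈ X τ, a.length ≤ M := by
    choose m hm using fun τ => ((hX τ).image List.length).bddAbove
    refine ⟨1 + m true + m false, by omega, fun τ a ha => ?_⟩
    have := hm τ ⟨a, ha, rfl⟩
    cases τ <;> omega
  obtain ⟨M, hM, hXM⟩ := hM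
  choose L hL using h.exists_length_le_of_mem_classOf hw hM hXM
  refine ⟨w.length * (1 + L true + L false), fun x hx => ?_⟩
  have key : Block.HasBlocks π (classOf π X) Set.univ w.length x := by
    refine h.induction hx (Block.hasBlocks_letters _ w) ?_
    intro p q ρ z z' hz hz' hx ih
    exact ih.step hw h.isClass (Set.mem_univ _) (mem_classOf hz) (mem_classOf hz') hx
  refine key.length_le (by omega) fun σ _ P z R hz hP => ?_
  have := hL σ P z R hz (EqRelativeTo.trans hx hP)
  cases σ <;> omega

theorem conditionStar (h : IsTwoSetSystem π X) (hX : ∀ τ, (X τ).Finite) : ConditionStar π := by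
  intro w hw
  obtain ⟨N, hN⟩ := h.exists_length_le hX hw
  -- The alphabet may be infinite, but rewriting introduces only letters of words in `X`.
  let S : Set A := {c | c ∈ w} ∪ ⋃ τ, ⋃ a ∈ X τ, {c | c ∈ a}
  have hS : S.Finite := (List.finite_toSet w).union
    (Set.finite_iUnion fun τ => (hX τ).biUnion fun a _ => List.finite_toSet a)
  have hmem : ∀ τ, ∀ a ∈ X τ, ∀ c ∈ a, c ∈ S := fun τ a ha c hc =>
    Or.inr (Set.mem_iUnion.2 ⟨τ, Set.mem_biUnion ha hc⟩)
  have : Finite S := hS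
  refine ((List.finite_length_le S N).image (List.map Subtype.val)).subset fun x hx => ?_
  have hxS : ∀ c ∈ x, c ∈ S := by
    refine h.induction (p := fun x => ∀ c ∈ x, c ∈ S) hx (fun c hc => Or.inl hc) ?_
    intro P R τ z z' _ hz' _ ih c hc
    simp only [List.mem_append] at hc ih
    rcases hc with (hc | hc) | hc
    · exact ih c (by simp [hc])
    · exact hmem τ z' hz' c hc
    · exact ih c (by simp [hc])
  lift x to List S using hxS
  exact ⟨x, by simpa using hN _ hx, rfl⟩

end IsTwoSetSystem

theorem EqRelativeTo.of_mem {A : Type*} {π : Set (List A × List A)} {a b : List A}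
    (h : (a, b) ∈ π) : EqRelativeTo π a b :=
  .single ⟨[], [], a, b, by simp, by simp, Or.inl h⟩

theorem eqRelativeTo_of_pairSystem_subset {A : Type*} {π : Set (List A × List A)} {n : ℕ}
    {u : Fin n → List A} (h : pairSystem u ⊆ π) (i j : Fin n) : EqRelativeTo π (u i) (u j) := by
  rcases lt_trichotomy i j with hij | rfl | hij
  · exact .of_mem (h ⟨i, j, hij, rfl⟩)
  · exact .refl _
  · exact (EqRelativeTo.of_mem (h ⟨j, i, hij, rfl⟩)).symm

theorem mainTheorem1 {A : Type*} :
    (∀ (n m : ℕ) (u : Fin n → List A) (v : Fin m → List A),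
      Function.Injective u → Function.Injective v →
        ConditionStar (pairSystem u ∪ pairSystem v)) ∧
    (∀ u v r s : List A, u ≠ v → r ≠ s →
      ConditionStar {(u, v), (r, s)}) := by
  constructor
  · intro n m u v _ _
    refine IsTwoSetSystem.conditionStar
      (X := fun τ => bif τ then Set.range u else Set.range v) ⟨?_, ?_⟩ ?_
    · rintro a b (⟨i, j, -, h⟩ | ⟨i, j, -, h⟩) <;> cases h
      · exact ⟨true, ⟨i, rfl⟩, ⟨j, rfl⟩⟩
      · exact ⟨false, ⟨i, rfl⟩, ⟨j, rfl⟩⟩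
    · rintro (_ | _) _ _ ⟨i, rfl⟩ ⟨j, rfl⟩
      · exact eqRelativeTo_of_pairSystem_subset Set.subset_union_right i j
      · exact eqRelativeTo_of_pairSystem_subset Set.subset_union_left i j
    · rintro (_ | _)
      · exact Set.finite_range v
      · exact Set.finite_range u
  · intro u v r s _ _
    have huv : EqRelativeTo {(u, v), (r, s)} u v := .of_mem (by simp)
    have hrs : EqRelativeTo {(u, v), (r, s)} r s := .of_mem (by simp)
    refine IsTwoSetSystem.conditionStar
      (X := fun τ => bif τ then {u, v} else {r, s}) ⟨?_, ?_⟩ ?_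
    · rintro a b (h | h) <;> cases h
      · exact ⟨true, by simp⟩
      · exact ⟨false, by simp⟩
    · rintro (_ | _) _ _ (rfl | rfl) (rfl | rfl)
      exacts [.refl _, hrs, hrs.symm, .refl _, .refl _, huv, huv.symm, .refl _]
    · rintro (_ | _) <;> simp
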